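/- Let $K_a\ge 1$, $d\ge 1$, $p=d+1$, let $T_1,\dots,T_d>1$ be integers and $T_p=N$, and let $\sigma>0$. For $1\le i\le p$, $1\le k\le K_a$ let $x_{i,k}\in\mathbb C^{T_i}$, where $x_{p,k}=h_k$ is the channel of user $k$, and write $x=(x_{i,k})$. For a parameter $\theta=(\theta_{i,k})$ with $\theta_{i,k}\in\mathbb C^{T_i}$, let $\mathbb E_\theta$ be the expectation under the model $$y=\sum_{k=1}^{K_a}\theta_{1,k}\otimes\dots\otimes\theta_{p,k}+w ,$$ where $w$ has i.i.d. circularly symmetric complex Gaussian entries of mean $0$ and variance $\sigma^2$. Let $$\mathcal M_x=\{\theta:\ \|\theta_{i,k}\|^2=\|x_{i,k}\|^2=T_i,\ \operatorname{Im}(x_{i,k}^H\theta_{i,k})=0\ \text{ for all }1\le i\le d,\ 1\le k\le K_a\}.$$ Let $\hat z=(\hat z_{i,k})$ be a measurable function of $y$ (an estimator of $x$) such that: - (norm and phase constraints) $\hat z(y)\in\mathcal M_x$ for every $y$; in particular $\|x_{i,k}\|^2=T_i$ for $1\le i\le d$; - (scalar bias) there are real factors $\alpha_{i,k}(\theta)$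 such that, for all $1\le i\le d$, $1\le k\le K_a$, $\mathbb E_x[\hat z_{i,k}]=\alpha_{i,k}(x)\,x_{i,k}$ and $\mathbb E_\theta[\hat z_{i,k}]=\alpha_{i,k}(\theta)\,\theta_{i,k}+o(\|\theta-x\|)$ as $\theta\to x$ in $\mathcal M_x$. (This holds in particular if $\mathbb E_\theta[\hat z_{i,k}]=\alpha_{i,k}\theta_{i,k}$ for all $\theta\in\mathcal M_x$ near $x$, with $\alpha_{i,k}$ constant or depending on $\theta$.) Fix $1\le i\le d$ and $1\le k\le K_a$, put $\alpha_{i,k}=\alpha_{i,k}(x)$, assume $\alpha_{i,k}\ne 0$, and define the normalized variance $$\xi_{i,k}=\frac{\mathbb E_x\big[\|\hat z_{i,k}-\alpha_{i,k}x_{i,k}\|^2\big]}{T_i\,\alpha_{i,k}^2}.$$ Let $s_{-i,k}$ be the Kronecker product of the $x_{j,k}$ over $1\le j\le p$, $j\ne i$; let $S_{-i}$ be the matrix with columns $s_{-i,1},\dots,s_{-i,K_a}$, let $\Gamma_i=S_{-i}^HS_{-i}$, and assume that $\Gamma_i$ is invertible. Let $P^\perp_{S_{-i,-k}}$ be the orthogonal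 projection onto the orthogonal complement of the span of the $s_{-i,k'}$, $k'\neq k$. Let $P^\perp_{x_{i,k}}$ be any matrix whose columns form an orthonormal basis of the orthogonal complement of $x_{i,k}$ in $\mathbb C^{T_i}$. With $e_k$ the $k$-th canonical basis vector, let $U_i$ be any matrix whose columns form an orthonormal basis of the span of the vectors $\Gamma_i^{-1/2}e_{k'}\otimes x_{i,k'}$, $k'\ne k$, and let $V_i=\frac{\Gamma_i^{-1/2}e_k}{\|\Gamma_i^{-1/2}e_k\|}\otimes P^\perp_{x_{i,k}}$. Then, with the Frobenius norm of $U_i^HV_i$, $$\xi_{i,k}\ \ge\ \frac{\big(T_i-1-\|U_i^HV_i\|^2\big)\,\sigma^2}{T_i\,\|P^\perp_{S_{-i,-k}}s_{-i,k}\|^2}.$$ If $K_a=1$, the right-hand side equals $\dfrac{\sigma^2(T_i-1)}{T_i\prod_{j\ne i}\|x_{j,k}\|^2}$ (product over $1\le j\le p$, $j\neq i$), and hence $\xi_{i,k}\ge\dfrac{\sigma^2(T_i-1)}{T_i\prod_{j\neq i}\|x_{j,k}\|^2}$. -/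

import Mathlib

open MeasureTheory ProbabilityTheory Filter Topology Asymptotics
open scoped BigOperators ENNReal NNReal Matrix MatrixOrder

namespace TensorCRB

noncomputable section

/-- The parameter `θ = (x_{i,k})`.  Modes are indexed by `Fin (d + 1)`: the modes `i.castSucc`
with `i : Fin d` carry information, and the last mode is the channel, `x_{d+1,k} = h_k`,
whose dimension `T (Fin.last d)` is the number of receive antennas. -/
abbrev Factors (d K : ℕ) (T : Fin (d + 1) → ℕ) : Type :=
  (i : Fin (d + 1)) → Fin K → EuclideanSpace ℂ (Fin (T i))

/-- Observations: complex arrays with one axis for each mode. -/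
abbrev Observation (d : ℕ) (T : Fin (d + 1) → ℕ) : Type :=
  ((i : Fin (d + 1)) → Fin (T i)) → ℂ

variable {d K : ℕ} {T : Fin (d + 1) → ℕ}

/-- The noiseless signal `∑ k, x_{1,k} ⊗ ⋯ ⊗ x_{d,k} ⊗ h_k`. -/
def signal (x : Factors d K T) : Observation d T :=
  fun r => ∑ k, ∏ i, x i k (r i)

/-- The circularly symmetric complex Gaussian law of total variance `σ²`: independent
real and imaginary parts, each centred with variance `σ² / 2`. -/
def complexGaussian (σ : ℝ) : Measure ℂ :=
  ((gaussianReal 0 (Real.toNNReal (σ ^ 2 / 2))).prod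
    (gaussianReal 0 (Real.toNNReal (σ ^ 2 / 2)))).map Complex.measurableEquivRealProd.symm

/-- The law of the noise `w`: i.i.d. complex Gaussian entries of variance `σ²`. -/
def noiseLaw (d : ℕ) (T : Fin (d + 1) → ℕ) (σ : ℝ) : Measure (Observation d T) :=
  Measure.pi fun _ => complexGaussian σ

/-- The law of the observation `y = signal x + w` under the parameter `x`. -/
def obsLaw (σ : ℝ) (x : Factors d K T) : Measure (Observation d T) :=
  (noiseLaw d T σ).map fun w => signal x + w

/-- The norm and phase constraints on `z`, with true parameter `x`, for all information
modes and all users: `‖z_{i,k}‖² = ‖x_{i,k}‖² = T_i` and `Im (x_{i,k}ᴴ z_{i,k}) = 0`. -/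
def SatisfiesConstraints (x z : Factors d K T) : Prop :=
  ∀ (i : Fin d) (k : Fin K),
    ‖z i.castSucc k‖ ^ 2 = ‖x i.castSucc k‖ ^ 2 ∧
    ‖x i.castSucc k‖ ^ 2 = (T i.castSucc : ℝ) ∧
    (inner ℂ (x i.castSucc k) (z i.castSucc k)).im = 0

/-- Scalar bias at the true parameter `x`, in the local sense of constrained Cramér-Rao
theory: `E_x[ẑ_{i,k}] = α_{i,k}(x) x_{i,k}`, and `E_θ[ẑ_{i,k}] = α_{i,k}(θ) θ_{i,k}` holds to
first order as `θ → x` inside the constraint set, for all information modes and all users.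
An estimator for which the equality is exact for all `θ` near `x` in the constraint set, with
factors `α_{i,k}` that may or may not depend on `θ`, is a special case. -/
def HasScalarBias (σ : ℝ) (x : Factors d K T) (Z : Observation d T → Factors d K T)
    (α : Factors d K T → Fin d → Fin K → ℝ) : Prop :=
  ∀ (i : Fin d) (k : Fin K),
    (∫ y, Z y i.castSucc k ∂(obsLaw σ x) = (α x i k : ℂ) • x i.castSucc k) ∧
    (fun θ : Factors d K T =>
        (∫ y, Z y i.castSucc k ∂(obsLaw σ θ)) - (α θ i k : ℂ) • θ i.castSucc k)
      =o[𝓝[{θ | SatisfiesConstraints x θ}] x] fun θ => θ - x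

/-- The normalized variance `ξ_{i,k} = E_x[‖ẑ_{i,k} - a x_{i,k}‖²] / (T_i a²)`, where `a` is
the bias factor at `x`. -/
def normalizedVariance (σ : ℝ) (x : Factors d K T) (Z : Observation d T → Factors d K T)
    (a : ℝ) (i : Fin (d + 1)) (k : Fin K) : ℝ :=
  (∫ y, ‖Z y i k - (a : ℂ) • x i k‖ ^ 2 ∂(obsLaw σ x)) / ((T i : ℝ) * a ^ 2)

/-- `s_{-i,k}`: the Kronecker product of the factors of user `k` with mode `i` omitted. -/
def partialKron (x : Factors d K T) (i : Fin (d + 1)) (k : Fin K) :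
    EuclideanSpace ℂ ((m : {m : Fin (d + 1) // m ≠ i}) → Fin (T m)) :=
  WithLp.toLp 2 fun r => ∏ m : {m : Fin (d + 1) // m ≠ i}, x m k (r m)

/-- `S_{-i}`: the matrix with columns `s_{-i,k}`. -/
def partialKronMatrix (x : Factors d K T) (i : Fin (d + 1)) :
    Matrix ((m : {m : Fin (d + 1) // m ≠ i}) → Fin (T m)) (Fin K) ℂ :=
  Matrix.of fun r k => partialKron x i k r

/-- `Γ_i = S_{-i}ᴴ S_{-i}`. -/
def gram (x : Factors d K T) (i : Fin (d + 1)) : Matrix (Fin K) (Fin K) ℂ :=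
  (partialKronMatrix x i)ᴴ * partialKronMatrix x i

/-- `Γ_i^{-1/2}`: the positive semidefinite square root of `Γ_i⁻¹`. -/
def gramInvSqrt (x : Factors d K T) (i : Fin (d + 1)) : Matrix (Fin K) (Fin K) ℂ :=
  CFC.sqrt (gram x i)⁻¹

/-- `Γ_i^{-1/2} e_k`. -/
def whitened (x : Factors d K T) (i : Fin (d + 1)) (k : Fin K) : EuclideanSpace ℂ (Fin K) :=
  WithLp.toLp 2 ((gramInvSqrt x i).col k)

/-- The Kronecker product of two vectors. -/
def kron {m n : Type} [Fintype m] [Fintype n] (u : EuclideanSpace ℂ m)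
    (v : EuclideanSpace ℂ n) : EuclideanSpace ℂ (m × n) :=
  WithLp.toLp 2 fun p => u p.1 * v p.2

/-- The span of the vectors `Γ_i^{-1/2} e_{k'} ⊗ x_{i,k'}`, `k' ≠ k`. -/
def interferenceSpan (x : Factors d K T) (i : Fin (d + 1)) (k : Fin K) :
    Submodule ℂ (EuclideanSpace ℂ (Fin K × Fin (T i))) :=
  Submodule.span ℂ (Set.range fun k' : {k' : Fin K // k' ≠ k} =>
    kron (whitened x i k') (x i k'))

/-- `U_i`, for an orthonormal basis `u` of `interferenceSpan x i k`. -/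
def matrixU (x : Factors d K T) (i : Fin (d + 1)) (k : Fin K) {ι : Type} [Fintype ι]
    (u : OrthonormalBasis ι ℂ (interferenceSpan x i k)) :
    Matrix (Fin K × Fin (T i)) ι ℂ :=
  Matrix.of fun p a => (u a : EuclideanSpace ℂ (Fin K × Fin (T i))) p

/-- `V_i = (Γ_i^{-1/2} e_k / ‖Γ_i^{-1/2} e_k‖) ⊗ P`, where the columns of `P` form the
orthonormal basis `v` of the orthogonal complement of `x_{i,k}`. -/
def matrixV (x : Factors d K T) (i : Fin (d + 1)) (k : Fin K) {κ : Type} [Fintype κ]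
    (v : OrthonormalBasis κ ℂ (Submodule.span ℂ {x i k})ᗮ) :
    Matrix (Fin K × Fin (T i)) κ ℂ :=
  Matrix.of fun p c =>
    kron (((‖whitened x i k‖⁻¹ : ℝ) : ℂ) • whitened x i k)
      (v c : EuclideanSpace ℂ (Fin (T i))) p

/-- The squared Frobenius norm. -/
def frobeniusSq {m n : Type} [Fintype m] [Fintype n] (A : Matrix m n ℂ) : ℝ :=
  ∑ a, ∑ b, ‖A a b‖ ^ 2

/-- `P^⊥ s_{-i,k}`, for the projection onto the orthogonal complement of the span of the
other columns `s_{-i,k'}`, `k' ≠ k`. -/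
def residual (x : Factors d K T) (i : Fin (d + 1)) (k : Fin K) :
    EuclideanSpace ℂ ((m : {m : Fin (d + 1) // m ≠ i}) → Fin (T m)) :=
  (Submodule.span ℂ (Set.range fun k' : {k' : Fin K // k' ≠ k} =>
    partialKron x i k'))ᗮ.starProjection (partialKron x i k)

/-- The lower bound `(T_i - 1 - ‖U_iᴴ V_i‖²) σ² / (T_i ‖P^⊥ s_{-i,k}‖²)`. -/
def varianceBound (σ : ℝ) (x : Factors d K T) (i : Fin (d + 1)) (k : Fin K)
    {ι κ : Type} [Fintype ι] [Fintype κ]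
    (u : OrthonormalBasis ι ℂ (interferenceSpan x i k))
    (v : OrthonormalBasis κ ℂ (Submodule.span ℂ {x i k})ᗮ) : ℝ :=
  (((T i : ℝ) - 1 - frobeniusSq ((matrixU x i k u)ᴴ * matrixV x i k v)) * σ ^ 2) /
    ((T i : ℝ) * ‖residual x i k‖ ^ 2)

/-- The single-user lower bound `σ² (T_i - 1) / (T_i ∏_{j ≠ i} ‖x_{j,k}‖²)`. -/
def singleUserBound (σ : ℝ) (x : Factors d K T) (i : Fin (d + 1)) (k : Fin K) : ℝ :=
  (σ ^ 2 * ((T i : ℝ) - 1)) /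
    ((T i : ℝ) * ∏ j ∈ Finset.univ.filter (fun j => j ≠ i), ‖x j k‖ ^ 2)

end

end TensorCRB

/-! The stronger bound `(T_i - 1) σ² / (T_i ‖residual‖²)` holds (`normalizedVariance_ge`); the
Frobenius term is nonnegative and only lowers it. Fix a unit vector `v` orthogonal to `x_{i,k}` and
write the residual as `∑ g_{k'} s_{-i,k'}` with `g_k = 1`. Moving every `x_{i,k'}` at once along
`g_{k'} v` moves the signal along `v ⊗ residual`: the other users' perturbations cancel the part of
`s_{-i,k}` that lies in their span, which makes the signal change as small as possible. The mean of
`⟨v, ẑ_{i,k}⟩` meanwhile has derivative `α_{i,k}`, so Cramér–Rao gives `α² σ² ≤ E|⟨v, ẑ_{i,k}⟩|²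
‖residual‖²` (`directional_variance_bound`). Summing over an orthonormal basis of the `T_i - 1`
dimensional complement of `x_{i,k}` and applying Bessel finishes the proof. Two points need care.
The perturbed factors leave the constraint set, but the signal sees only the product of a user's
factors, so a complex scalar restoring norm and phase can be moved to the unconstrained channel
(`gaugedLine`). And `α` may vary with `θ`: its continuity along the line follows from that of the
mean, and no derivative of `α` enters because `v` is orthogonal to `x_{i,k}`. The Cramér–Rao step
(`cramer_rao_complex_direction`) is the limit of a Chapman–Robbins inequality, so the likelihood is
never differentiated. -/

namespace TensorCRB

/-! ### Shifted Gaussian laws: densities and chi-squared divergence -/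

section CameronMartin

/-- On a finite product, a product of densities is the density of the product measure. -/
lemma pi_withDensity_ofReal_prod {ι : Type*} [Fintype ι] {E : ι → Type*}
    [∀ i, MeasurableSpace (E i)] (μ : (i : ι) → Measure (E i)) [∀ i, IsFiniteMeasure (μ i)]
    (f : (i : ι) → E i → ℝ) (hf0 : ∀ i x, 0 ≤ f i x) (hf : ∀ i, Integrable (f i) (μ i)) :
    (Measure.pi μ).withDensity (fun x => ENNReal.ofReal (∏ i, f i (x i))) =
      Measure.pi fun i => (μ i).withDensity fun x => ENNReal.ofReal (f i x) := by
  have hfin : ∀ i, IsFiniteMeasure ((μ i).withDensity fun x => ENNReal.ofReal (f i x)) :=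
    fun i => isFiniteMeasure_withDensity_ofReal (hf i).2
  refine (Measure.pi_eq fun s hs => ?_).symm
  rw [withDensity_apply _ (MeasurableSet.univ_pi hs), Measure.restrict_pi_pi,
    ← ofReal_integral_eq_lintegral_ofReal]
  · rw [integral_fintype_prod_eq_prod f,
      ENNReal.ofReal_prod_of_nonneg fun i _ => integral_nonneg (hf0 i)]
    refine Finset.prod_congr rfl fun i _ => ?_
    rw [withDensity_apply _ (hs i),
      ofReal_integral_eq_lintegral_ofReal (hf i).restrict (Eventually.of_forall (hf0 i))]
  · exact Integrable.fintype_prod_dep fun i => (hf i).restrict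
  · exact Eventually.of_forall fun x => Finset.prod_nonneg fun i _ => hf0 i _

/-- The density of a shifted real Gaussian law with respect to the centred one. -/
lemma gaussianReal_withDensity {v : ℝ≥0} (hv : v ≠ 0) (a : ℝ) :
    gaussianReal a v = (gaussianReal 0 v).withDensity
      fun t => ENNReal.ofReal (Real.exp ((2 * a * t - a ^ 2) / (2 * v))) := by
  rw [gaussianReal_of_var_ne_zero a hv, gaussianReal_of_var_ne_zero 0 hv,
    ← withDensity_mul _ (measurable_gaussianPDF 0 v) (by fun_prop)]
  congr 1
  ext t
  have hv' : (v : ℝ) ≠ 0 := by exact_mod_cast hv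
  rw [Pi.mul_apply, gaussianPDF, gaussianPDF, ← ENNReal.ofReal_mul (gaussianPDFReal_nonneg _ _ _),
    gaussianPDFReal, gaussianPDFReal, mul_assoc _ (Real.exp _) (Real.exp _), ← Real.exp_add]
  congr 4
  field_simp
  ring

/-- The density of the complex Gaussian law shifted by `a` with respect to the centred one,
at the point `z`. -/
noncomputable def complexShiftDensity (σ : ℝ) (a z : ℂ) : ℝ :=
  Real.exp ((2 * (inner ℝ a z) - ‖a‖ ^ 2) / σ ^ 2)

lemma complexShiftDensity_nonneg (σ : ℝ) (a z : ℂ) : 0 ≤ complexShiftDensity σ a z :=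
  (Real.exp_pos _).le

@[fun_prop]
lemma measurable_complexShiftDensity (σ : ℝ) (a : ℂ) : Measurable (complexShiftDensity σ a) := by
  unfold complexShiftDensity
  fun_prop

instance (σ : ℝ) : IsProbabilityMeasure (complexGaussian σ) :=
  Measure.isProbabilityMeasure_map (MeasurableEquiv.measurable _).aemeasurable

/-- Each coordinate has variance `σ² / 2`, so the denominator `2v` of the real density is `σ²`, and
the two exponents add up to the real inner product on `ℂ`. -/
lemma complexGaussian_map_add {σ : ℝ} (hσ : 0 < σ) (a : ℂ) :
    (complexGaussian σ).map (fun z => a + z) =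
      (complexGaussian σ).withDensity fun z => ENNReal.ofReal (complexShiftDensity σ a z) := by
  set v := Real.toNNReal (σ ^ 2 / 2) with hvdef
  have hvv : (v : ℝ) = σ ^ 2 / 2 := Real.coe_toNNReal _ (by positivity)
  have hv : v ≠ 0 := by
    rintro h
    rw [h, NNReal.coe_zero] at hvv
    have : 0 < σ ^ 2 / 2 := by positivity
    linarith
  set e := Complex.measurableEquivRealProd.symm with he
  have hmap : (complexGaussian σ).map (fun z => a + z) =
      ((gaussianReal a.re v).prod (gaussianReal a.im v)).map e := by
    rw [complexGaussian, Measure.map_map (by fun_prop) e.measurable]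
    have h1 := gaussianReal_map_const_add (μ := 0) (v := v) a.re
    have h2 := gaussianReal_map_const_add (μ := 0) (v := v) a.im
    rw [zero_add] at h1 h2
    rw [← h1, ← h2, Measure.map_prod_map _ _ (by fun_prop) (by fun_prop),
      Measure.map_map e.measurable (by fun_prop)]
    rfl
  rw [hmap, gaussianReal_withDensity hv a.re, gaussianReal_withDensity hv a.im,
    prod_withDensity (by fun_prop) (by fun_prop)]
  ext s hs
  rw [Measure.map_apply e.measurable hs, withDensity_apply _ (e.measurable hs),
    withDensity_apply _ hs, complexGaussian, ← hvdef, ← he, setLIntegral_map hs (by fun_prop) e.measurable]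
  refine lintegral_congr fun p => ?_
  rw [← ENNReal.ofReal_mul (Real.exp_pos _).le, ← Real.exp_add, complexShiftDensity, hvv]
  congr 2
  have : (inner ℝ a (e p) : ℝ) = a.re * p.1 + a.im * p.2 := by
    simp [he, Complex.inner, Complex.measurableEquivRealProd]
    ring
  rw [this, ← Complex.normSq_eq_norm_sq, Complex.normSq_apply]
  field_simp
  ring

lemma integrable_complexShiftDensity {σ : ℝ} (hσ : 0 < σ) (a : ℂ) :
    Integrable (complexShiftDensity σ a) (complexGaussian σ) := by
  refine ⟨by fun_prop, ?_⟩
  have h := congrArg (fun μ : Measure ℂ => μ Set.univ) (complexGaussian_map_add hσ a)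
  simp only [withDensity_apply _ MeasurableSet.univ, Measure.restrict_univ] at h
  rw [hasFiniteIntegral_iff_ofReal (Eventually.of_forall (complexShiftDensity_nonneg σ a)), ← h]
  exact measure_lt_top _ _

variable {d K : ℕ} {T : Fin (d + 1) → ℕ}

/-- The density of the noise law shifted by `a` with respect to the noise law. -/
noncomputable def shiftDensity (σ : ℝ) (a w : Observation d T) : ℝ :=
  ∏ r, complexShiftDensity σ (a r) (w r)

lemma shiftDensity_nonneg (σ : ℝ) (a w : Observation d T) : 0 ≤ shiftDensity σ a w :=
  Finset.prod_nonneg fun _ _ => complexShiftDensity_nonneg _ _ _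

@[fun_prop]
lemma measurable_shiftDensity (σ : ℝ) (a : Observation d T) :
    Measurable (shiftDensity σ a) := by
  unfold shiftDensity
  fun_prop

/-- Doubling the exponent doubles the linear term, as a shift by `2a` does, and leaves a constant
from the quadratic term. The second moment of a density thus reduces to the total mass of another.
-/
lemma shiftDensity_sq (σ : ℝ) (a w : Observation d T) :
    shiftDensity σ a w ^ 2 =
      Real.exp (2 * (∑ r, ‖a r‖ ^ 2) / σ ^ 2) * shiftDensity σ ((2 : ℝ) • a) w := by
  unfold shiftDensity complexShiftDensity
  rw [← Real.exp_sum, ← Real.exp_sum, ← Real.exp_add, ← Real.exp_nat_mul, Finset.mul_sum,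
    Finset.mul_sum, Finset.sum_div, ← Finset.sum_add_distrib]
  congr 1
  refine Finset.sum_congr rfl fun r _ => ?_
  simp only [Pi.smul_apply, norm_smul, inner_smul_left]
  simp
  ring

instance (σ : ℝ) : IsProbabilityMeasure (noiseLaw d T σ) := by
  unfold noiseLaw
  infer_instance

instance (σ : ℝ) (x : Factors d K T) : IsProbabilityMeasure (obsLaw σ x) :=
  Measure.isProbabilityMeasure_map (by fun_prop)

/-- **Cameron–Martin formula** for the noise law. -/
lemma noiseLaw_map_add {σ : ℝ} (hσ : 0 < σ) (a : Observation d T) :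
    (noiseLaw d T σ).map (fun w => a + w) =
      (noiseLaw d T σ).withDensity fun w => ENNReal.ofReal (shiftDensity σ a w) := by
  unfold shiftDensity noiseLaw
  rw [pi_withDensity_ofReal_prod _ (fun r => complexShiftDensity σ (a r))
    (fun r => complexShiftDensity_nonneg σ (a r)) fun r => integrable_complexShiftDensity hσ (a r)]
  simp_rw [← complexGaussian_map_add hσ]
  have := Measure.pi_map_pi (μ := fun _ : ((i : Fin (d + 1)) → Fin (T i)) => complexGaussian σ)
    (f := fun r z => a r + z) (fun _ => by fun_prop)
  exact this

lemma obsLaw_eq_withDensity {σ : ℝ} (hσ : 0 < σ) {x θ : Factors d K T} {a : Observation d T}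
    (h : signal θ = signal x + a) :
    obsLaw σ θ = (obsLaw σ x).withDensity
      fun y => ENNReal.ofReal (shiftDensity σ a (y - signal x)) := by
  have h1 : obsLaw σ θ = ((noiseLaw d T σ).map fun w => a + w).map fun w => signal x + w := by
    rw [Measure.map_map (by fun_prop) (by fun_prop), obsLaw, h]
    simp only [Function.comp_def, add_assoc]
  rw [h1, noiseLaw_map_add hσ]
  ext s hs
  rw [Measure.map_apply (by fun_prop) hs,
    withDensity_apply _ ((by fun_prop : Measurable fun w => signal x + w) hs),
    withDensity_apply _ hs, obsLaw, setLIntegral_map hs (by fun_prop) (by fun_prop)]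
  simp

lemma integral_shiftDensity {σ : ℝ} (hσ : 0 < σ) (x : Factors d K T) (a : Observation d T) :
    Integrable (fun y => shiftDensity σ a (y - signal x)) (obsLaw σ x) ∧
      ∫ y, shiftDensity σ a (y - signal x) ∂(obsLaw σ x) = 1 := by
  have h0 : 0 ≤ᵐ[obsLaw σ x] fun y => shiftDensity σ a (y - signal x) :=
    Eventually.of_forall fun y => shiftDensity_nonneg _ _ _
  have h1 : ∫⁻ y, ENNReal.ofReal (shiftDensity σ a (y - signal x)) ∂(obsLaw σ x) = 1 := by
    have e : (obsLaw σ x) = (noiseLaw d T σ).map fun w => signal x + w := rfl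
    rw [e, lintegral_map (by fun_prop) (by fun_prop)]
    simp only [add_sub_cancel_left]
    have h := congrArg (fun μ : Measure _ => μ Set.univ) (noiseLaw_map_add hσ a)
    simp only [withDensity_apply _ MeasurableSet.univ, Measure.restrict_univ] at h
    rw [← h, Measure.map_apply (by fun_prop) MeasurableSet.univ]
    simp
  have hm : Measurable fun y => shiftDensity σ a (y - signal x) := by fun_prop
  refine ⟨⟨hm.aestronglyMeasurable, ?_⟩, ?_⟩
  · rw [hasFiniteIntegral_iff_ofReal h0, h1]
    exact ENNReal.one_lt_top
  · rw [integral_eq_lintegral_of_nonneg_ae h0 hm.aestronglyMeasurable, h1]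
    rfl

/-- The chi-squared divergence between the laws with signals `signal x + a` and `signal x`. -/
lemma integral_shiftDensity_sub_one_sq {σ : ℝ} (hσ : 0 < σ) (x : Factors d K T)
    (a : Observation d T) :
    Integrable (fun y => (shiftDensity σ a (y - signal x) - 1) ^ 2) (obsLaw σ x) ∧
      ∫ y, (shiftDensity σ a (y - signal x) - 1) ^ 2 ∂(obsLaw σ x) =
        Real.exp (2 * (∑ r, ‖a r‖ ^ 2) / σ ^ 2) - 1 := by
  obtain ⟨i1, e1⟩ := integral_shiftDensity hσ x a
  obtain ⟨i2, e2⟩ := integral_shiftDensity hσ x ((2 : ℝ) • a)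
  have hsq : (fun y => (shiftDensity σ a (y - signal x) - 1) ^ 2) = fun y =>
      Real.exp (2 * (∑ r, ‖a r‖ ^ 2) / σ ^ 2) * shiftDensity σ ((2 : ℝ) • a) (y - signal x) -
        2 * shiftDensity σ a (y - signal x) + 1 := by
    ext y
    rw [← shiftDensity_sq]
    ring
  rw [hsq]
  have i3 : Integrable (fun y =>
      Real.exp (2 * (∑ r, ‖a r‖ ^ 2) / σ ^ 2) * shiftDensity σ ((2 : ℝ) • a) (y - signal x) -
        2 * shiftDensity σ a (y - signal x)) (obsLaw σ x) := (i2.const_mul (Real.exp (2 * (∑ r, ‖a r‖ ^ 2) / σ ^ 2))).sub (i1.const_mul 2)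
  refine ⟨i3.add (integrable_const 1), ?_⟩
  rw [integral_add i3 (integrable_const 1), integral_sub (i2.const_mul _) (i1.const_mul 2),
    integral_const_mul, integral_const_mul, e1, e2]
  simp
  ring

end CameronMartin

end TensorCRB

namespace TensorCRB

/-! ### Chapman–Robbins and Cramér–Rao inequalities -/

section Information

/-- The Cauchy–Schwarz inequality for integrals of complex functions. -/
lemma norm_integral_mul_sq_le {Ω : Type*} [MeasurableSpace Ω] {μ : Measure Ω} {f g : Ω → ℂ}
    (hf : MemLp f 2 μ) (hg : MemLp g 2 μ) :
    ‖∫ y, f y * g y ∂μ‖ ^ 2 ≤ (∫ y, ‖f y‖ ^ 2 ∂μ) * ∫ y, ‖g y‖ ^ 2 ∂μ := by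
  have h1 : ‖∫ y, f y * g y ∂μ‖ ≤ ∫ y, ‖f y‖ * ‖g y‖ ∂μ := by
    simpa only [norm_mul] using norm_integral_le_integral_norm (μ := μ) fun y => f y * g y
  have h2 := integral_mul_norm_le_Lp_mul_Lq (μ := μ) Real.HolderConjugate.two_two
    (by simpa using hf) (by simpa using hg)
  simp only [Real.rpow_two, ← Real.sqrt_eq_rpow] at h2
  have h3 : ‖∫ y, f y * g y ∂μ‖ ^ 2 ≤ (√(∫ y, ‖f y‖ ^ 2 ∂μ) * √(∫ y, ‖g y‖ ^ 2 ∂μ)) ^ 2 :=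
    pow_le_pow_left₀ (norm_nonneg _) (h1.trans h2) 2
  rwa [mul_pow, Real.sq_sqrt (integral_nonneg fun _ => by positivity),
    Real.sq_sqrt (integral_nonneg fun _ => by positivity)] at h3

variable {d K : ℕ} {T : Fin (d + 1) → ℕ} {σ : ℝ} {x θ : Factors d K T} {f : Observation d T → ℂ}

lemma memLp_shiftDensity_sub_one (hσ : 0 < σ) (x : Factors d K T) (a : Observation d T) :
    MemLp (fun y => ((shiftDensity σ a (y - signal x) - 1 : ℝ) : ℂ)) 2 (obsLaw σ x) := by
  have hm : Measurable fun y => shiftDensity σ a (y - signal x) - 1 := by fun_prop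
  exact ((memLp_two_iff_integrable_sq hm.aestronglyMeasurable).2
    (integral_shiftDensity_sub_one_sq hσ x a).1).ofReal

lemma integrable_mul_shiftDensity_sub_one (hσ : 0 < σ) (hf : MemLp f 2 (obsLaw σ x))
    (a : Observation d T) :
    Integrable (fun y => f y * ((shiftDensity σ a (y - signal x) - 1 : ℝ) : ℂ)) (obsLaw σ x) :=
  MemLp.integrable_mul hf (memLp_shiftDensity_sub_one hσ x a)

/-- Change of the expectation under a shift of the signal. -/
lemma integral_obsLaw_sub (hσ : 0 < σ) (hf : MemLp f 2 (obsLaw σ x)) {a : Observation d T}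
    (h : signal θ = signal x + a) :
    ∫ y, f y ∂(obsLaw σ θ) - ∫ y, f y ∂(obsLaw σ x) =
      ∫ y, f y * ((shiftDensity σ a (y - signal x) - 1 : ℝ) : ℂ) ∂(obsLaw σ x) := by
  have i1 : Integrable f (obsLaw σ x) := hf.integrable (by norm_num)
  have i2 := integrable_mul_shiftDensity_sub_one hσ hf a
  rw [sub_eq_iff_eq_add, ← integral_add i2 i1, obsLaw_eq_withDensity hσ h,
    integral_withDensity_eq_integral_toReal_smul (by fun_prop)
      (Eventually.of_forall fun _ => ENNReal.ofReal_lt_top)]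
  refine integral_congr_ae (Eventually.of_forall fun y => ?_)
  simp only [ENNReal.toReal_ofReal (shiftDensity_nonneg _ _ _), Complex.real_smul]
  push_cast
  ring

/-- A Chapman–Robbins inequality for one shift of the signal. -/
lemma norm_integral_obsLaw_sub_sq_le (hσ : 0 < σ) (hf : MemLp f 2 (obsLaw σ x))
    {a : Observation d T} (h : signal θ = signal x + a) :
    ‖∫ y, f y ∂(obsLaw σ θ) - ∫ y, f y ∂(obsLaw σ x)‖ ^ 2 ≤
      (∫ y, ‖f y‖ ^ 2 ∂(obsLaw σ x)) * (Real.exp (2 * (∑ r, ‖a r‖ ^ 2) / σ ^ 2) - 1) := by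
  rw [integral_obsLaw_sub hσ hf h]
  refine (norm_integral_mul_sq_le hf (memLp_shiftDensity_sub_one hσ x a)).trans_eq ?_
  simp only [Complex.norm_real, Real.norm_eq_abs, sq_abs,
    (integral_shiftDensity_sub_one_sq hσ x a).2]

/-- A Chapman–Robbins inequality for a pair of shifts of the signal, one for the real and one
for the imaginary direction. -/
lemma norm_integral_obsLaw_sub_pair_sq_le (hσ : 0 < σ) (hf : MemLp f 2 (obsLaw σ x))
    {a b : Observation d T} {θ' : Factors d K T} (h : signal θ = signal x + a)
    (h' : signal θ' = signal x + b) :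
    ‖(∫ y, f y ∂(obsLaw σ θ) - ∫ y, f y ∂(obsLaw σ x)) -
        Complex.I * (∫ y, f y ∂(obsLaw σ θ') - ∫ y, f y ∂(obsLaw σ x))‖ ^ 2 ≤
      (∫ y, ‖f y‖ ^ 2 ∂(obsLaw σ x)) *
        ((Real.exp (2 * (∑ r, ‖a r‖ ^ 2) / σ ^ 2) - 1) +
          (Real.exp (2 * (∑ r, ‖b r‖ ^ 2) / σ ^ 2) - 1)) := by
  have ha := memLp_shiftDensity_sub_one hσ x a
  have hb := (memLp_shiftDensity_sub_one hσ x b).const_mul Complex.I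
  rw [integral_obsLaw_sub hσ hf h, integral_obsLaw_sub hσ hf h', ← integral_const_mul,
    ← integral_sub (integrable_mul_shiftDensity_sub_one hσ hf a)
      ((integrable_mul_shiftDensity_sub_one hσ hf b).const_mul Complex.I)]
  have e : ∀ y, f y * ((shiftDensity σ a (y - signal x) - 1 : ℝ) : ℂ) -
      Complex.I * (f y * ((shiftDensity σ b (y - signal x) - 1 : ℝ) : ℂ)) =
      f y * (((shiftDensity σ a (y - signal x) - 1 : ℝ) : ℂ) -
        Complex.I * ((shiftDensity σ b (y - signal x) - 1 : ℝ) : ℂ)) := fun y => by ring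
  simp_rw [e]
  refine (norm_integral_mul_sq_le hf (ha.sub hb)).trans_eq ?_
  rw [← (integral_shiftDensity_sub_one_sq hσ x a).2, ← (integral_shiftDensity_sub_one_sq hσ x b).2,
    ← integral_add (integral_shiftDensity_sub_one_sq hσ x a).1
      (integral_shiftDensity_sub_one_sq hσ x b).1]
  congr 1
  -- For real `p`, `q` one has `|p - i q|² = p² + q²`, so the two shifts contribute without a cross
  -- term.
  refine integral_congr_ae (Eventually.of_forall fun y => ?_)
  simp only [Pi.sub_apply]
  rw [← Complex.normSq_eq_norm_sq, Complex.normSq_apply]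
  simp
  ring

lemma tendsto_exp_mul_sq_sub_one_div_sq (c : ℝ) :
    Tendsto (fun t : ℝ => (Real.exp (c * t ^ 2) - 1) / t ^ 2) (𝓝[≠] 0) (𝓝 c) := by
  have h : HasDerivAt (fun s : ℝ => Real.exp (c * s)) c 0 := by
    simpa using ((hasDerivAt_id (0 : ℝ)).const_mul c).exp
  have hs := hasDerivAt_iff_tendsto_slope.1 h
  have ht : Tendsto (fun t : ℝ => t ^ 2) (𝓝[≠] 0) (𝓝[≠] 0) := by
    refine tendsto_nhdsWithin_iff.2 ⟨?_, ?_⟩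
    · have : Tendsto (fun t : ℝ => t ^ 2) (𝓝 0) (𝓝 (0 ^ 2)) := (continuous_pow 2).tendsto 0
      rw [zero_pow two_ne_zero] at this
      exact this.mono_left nhdsWithin_le_nhds
    · filter_upwards [self_mem_nhdsWithin] with t ht
      exact pow_ne_zero 2 ht
  refine (hs.comp ht).congr fun t => ?_
  simp [slope_def_field]

lemma sum_norm_smul_sq (t : ℝ) (a : Observation d T) :
    ∑ r, ‖(t • a) r‖ ^ 2 = t ^ 2 * ∑ r, ‖a r‖ ^ 2 := by
  rw [Finset.mul_sum]
  refine Finset.sum_congr rfl fun r _ => ?_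
  rw [Pi.smul_apply, norm_smul, mul_pow, Real.norm_eq_abs, sq_abs]

/-- **Cramér–Rao inequality** along a complex direction: if the mean of `f` vanishes at `x` and
has derivatives `β` and `i β` along the signal directions `a` and `i a`, then
`|β|² σ² ≤ E|f|² ‖a‖²`. -/
lemma cramer_rao_complex_direction (hσ : 0 < σ) (hf : MemLp f 2 (obsLaw σ x))
    (h0 : ∫ y, f y ∂(obsLaw σ x) = 0) {a : Observation d T} {β : ℂ} {θ θ' : ℝ → Factors d K T}
    (hθ : ∀ᶠ t in 𝓝[≠] (0 : ℝ), signal (θ t) = signal x + t • a)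
    (hθ' : ∀ᶠ t in 𝓝[≠] (0 : ℝ), signal (θ' t) = signal x + t • (Complex.I • a))
    (hm : Tendsto (fun t : ℝ => (t : ℂ)⁻¹ * ∫ y, f y ∂(obsLaw σ (θ t))) (𝓝[≠] 0) (𝓝 β))
    (hm' : Tendsto (fun t : ℝ => (t : ℂ)⁻¹ * ∫ y, f y ∂(obsLaw σ (θ' t))) (𝓝[≠] 0)
      (𝓝 (Complex.I * β))) :
    ‖β‖ ^ 2 * σ ^ 2 ≤ (∫ y, ‖f y‖ ^ 2 ∂(obsLaw σ x)) * ∑ r, ‖a r‖ ^ 2 := by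
  have hl : Tendsto (fun t : ℝ => ‖(t : ℂ)⁻¹ * ∫ y, f y ∂(obsLaw σ (θ t)) -
      Complex.I * ((t : ℂ)⁻¹ * ∫ y, f y ∂(obsLaw σ (θ' t)))‖ ^ 2) (𝓝[≠] 0)
      (𝓝 (‖β - Complex.I * (Complex.I * β)‖ ^ 2)) :=
    ((hm.sub (hm'.const_mul _)).norm).pow 2
  -- The two slopes `β` and `i β` reinforce each other: the left side is multiplied by 4, the
  -- divergence only by 2. One real direction alone would lose this factor 2.
  have hβ : ‖β - Complex.I * (Complex.I * β)‖ ^ 2 = 4 * ‖β‖ ^ 2 := by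
    rw [← mul_assoc, Complex.I_mul_I, show β - -1 * β = 2 * β by ring, norm_mul, mul_pow]
    norm_num
  set S := ∑ r, ‖a r‖ ^ 2 with hS
  have hr := (((tendsto_exp_mul_sq_sub_one_div_sq (2 * S / σ ^ 2)).const_mul 2).const_mul
    (∫ y, ‖f y‖ ^ 2 ∂(obsLaw σ x)))
  have hle := le_of_tendsto_of_tendsto hl hr (by
    filter_upwards [hθ, hθ', self_mem_nhdsWithin] with t h1 h2 ht
    have ht : t ≠ 0 := ht
    have h := norm_integral_obsLaw_sub_pair_sq_le hσ hf h1 h2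
    have hI : ∑ r, ‖(Complex.I • a) r‖ ^ 2 = S := by simp [hS]
    rw [h0, sub_zero, sub_zero, sum_norm_smul_sq, sum_norm_smul_sq, hI, ← hS] at h
    rw [show ∀ u w : ℂ, (t : ℂ)⁻¹ * u - Complex.I * ((t : ℂ)⁻¹ * w) =
      (t : ℂ)⁻¹ * (u - Complex.I * w) from fun u w => by ring, norm_mul, mul_pow, norm_inv,
      Complex.norm_real, Real.norm_eq_abs, inv_pow, sq_abs]
    rw [show 2 * S / σ ^ 2 * t ^ 2 = 2 * (t ^ 2 * S) / σ ^ 2 by ring]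
    have ht2 : 0 < t ^ 2 := by positivity
    rw [inv_mul_le_iff₀ ht2]
    refine h.trans_eq ?_
    field_simp
    ring)
  rw [hβ] at hle
  have hσ2 : 0 < σ ^ 2 := by positivity
  have e : (∫ y, ‖f y‖ ^ 2 ∂(obsLaw σ x)) * (2 * (2 * S / σ ^ 2)) * σ ^ 2 =
      4 * ((∫ y, ‖f y‖ ^ 2 ∂(obsLaw σ x)) * S) := by
    field_simp
    ring
  nlinarith [mul_le_mul_of_nonneg_right hle hσ2.le]

/-- Continuity of the mean of `f` along a line of signals. -/
lemma tendsto_integral_obsLaw (hσ : 0 < σ) (hf : MemLp f 2 (obsLaw σ x))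
    {a : Observation d T} {θ : ℝ → Factors d K T}
    (hθ : ∀ᶠ t in 𝓝[≠] (0 : ℝ), signal (θ t) = signal x + t • a) :
    Tendsto (fun t : ℝ => ∫ y, f y ∂(obsLaw σ (θ t))) (𝓝[≠] 0)
      (𝓝 (∫ y, f y ∂(obsLaw σ x))) := by
  rw [tendsto_iff_norm_sub_tendsto_zero]
  have hr : Tendsto (fun t : ℝ => √((∫ y, ‖f y‖ ^ 2 ∂(obsLaw σ x)) *
      (Real.exp (2 * (t ^ 2 * ∑ r, ‖a r‖ ^ 2) / σ ^ 2) - 1))) (𝓝[≠] 0) (𝓝 0) := by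
    have hc : Continuous fun t : ℝ => √((∫ y, ‖f y‖ ^ 2 ∂(obsLaw σ x)) *
      (Real.exp (2 * (t ^ 2 * ∑ r, ‖a r‖ ^ 2) / σ ^ 2) - 1)) := by fun_prop
    have := (hc.tendsto 0).mono_left (nhdsWithin_le_nhds (s := {0}ᶜ))
    simpa using this
  refine squeeze_zero' (Eventually.of_forall fun _ => norm_nonneg _) ?_ hr
  filter_upwards [hθ] with t ht
  refine Real.le_sqrt_of_sq_le ?_
  have := norm_integral_obsLaw_sub_sq_le hσ hf ht
  rwa [sum_norm_smul_sq] at this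

end Information

end TensorCRB

namespace TensorCRB

/-! ### Normalising norm and phase -/

section Gauge

variable {E : Type*} [NormedAddCommGroup E] [InnerProductSpace ℂ E]

/-- The complex factor by which `z` has to be divided to get the norm of `a` and a real inner
product with `a`. -/
noncomputable def gauge (a z : E) : ℂ :=
  inner ℂ a z * (‖z‖ : ℂ) / ((‖inner ℂ a z‖ : ℂ) * (‖a‖ : ℂ))

lemma gauge_ne_zero {a z : E} (h : inner ℂ a z ≠ 0) : gauge a z ≠ 0 := by
  have ha : a ≠ 0 := by rintro rfl; simp at h
  have hz : z ≠ 0 := by rintro rfl; simp at h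
  unfold gauge
  simp [h, ha, hz]

lemma norm_inv_gauge_smul {a z : E} (h : inner ℂ a z ≠ 0) : ‖(gauge a z)⁻¹ • z‖ = ‖a‖ := by
  have ha : ‖a‖ ≠ 0 := by rw [norm_ne_zero_iff]; rintro rfl; simp at h
  have hz : ‖z‖ ≠ 0 := by rw [norm_ne_zero_iff]; rintro rfl; simp at h
  have hi : ‖inner ℂ a z‖ ≠ 0 := norm_ne_zero_iff.2 h
  simp only [gauge, norm_smul, norm_inv, norm_div, norm_mul, Complex.norm_real, norm_norm]
  field_simp

lemma im_inner_inv_gauge_smul {a z : E} (h : inner ℂ a z ≠ 0) :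
    (inner ℂ a ((gauge a z)⁻¹ • z)).im = 0 := by
  have hz : ‖z‖ ≠ 0 := by rw [norm_ne_zero_iff]; rintro rfl; simp at h
  have e : inner ℂ a ((gauge a z)⁻¹ • z) = ((‖inner ℂ a z‖ * ‖a‖ / ‖z‖ : ℝ) : ℂ) := by
    rw [inner_smul_right, gauge]
    push_cast
    have hz' : (‖z‖ : ℂ) ≠ 0 := by exact_mod_cast hz
    field_simp
  rw [e, Complex.ofReal_im]

lemma gauge_self {a : E} (ha : a ≠ 0) : gauge a a = 1 := by
  have h : (‖a‖ : ℂ) ≠ 0 := by simpa using ha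
  rw [gauge, inner_self_eq_norm_sq_to_K]
  simp [ha]

/-- The norms in `gauge` are smooth away from zero, and at `t = 0` neither the vector nor its inner
product with `a` vanishes. -/
lemma differentiableAt_gauge {a : E} (ha : a ≠ 0) (δ : E) :
    DifferentiableAt ℝ (fun t : ℝ => gauge a (a + (t : ℂ) • δ)) 0 := by
  have h0 : inner ℂ a a ≠ 0 := inner_self_ne_zero.2 ha
  have h1 : DifferentiableAt ℝ (fun t : ℝ => a + (t : ℂ) • δ) 0 := by
    simp only [Complex.coe_smul]
    fun_prop
  have h2 : DifferentiableAt ℝ (fun t : ℝ => inner ℂ a (a + (t : ℂ) • δ)) 0 :=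
    (differentiableAt_const a).inner ℂ h1
  have h3 : DifferentiableAt ℝ (fun t : ℝ => ((‖a + (t : ℂ) • δ‖ : ℝ) : ℂ)) 0 :=
    Complex.ofRealCLM.differentiableAt.comp 0 (h1.norm ℂ (by simpa using ha))
  have h4 : DifferentiableAt ℝ (fun t : ℝ => ((‖inner ℂ a (a + (t : ℂ) • δ)‖ : ℝ) : ℂ)) 0 :=
    Complex.ofRealCLM.differentiableAt.comp 0 (h2.norm ℝ (by simpa using h0))
  unfold gauge
  refine (h2.mul h3).fun_div (h4.mul (differentiableAt_const _)) ?_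
  simpa using ha

end Gauge

/-! ### Curves in the constraint set with affine signal -/

section Curve

variable {d K : ℕ} {T : Fin (d + 1) → ℕ} {σ : ℝ} {x : Factors d K T}

lemma prod_update_apply (x : Factors d K T) (i : Fin (d + 1))
    (u : Fin K → EuclideanSpace ℂ (Fin (T i))) (k : Fin K) (r : (i : Fin (d + 1)) → Fin (T i)) :
    ∏ j, Function.update x i u j k (r j) =
      u k (r i) * partialKron x i k fun m => r m := by
  rw [Fintype.prod_eq_mul_prod_subtype_ne _ i, Function.update_self, partialKron]
  congr 1
  refine Finset.prod_congr rfl fun m _ => ?_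
  rw [Function.update_of_ne m.2]

/-- The signal is additive in the factors of one mode. -/
lemma signal_update_add_smul (x : Factors d K T) (i : Fin (d + 1))
    (δ : Fin K → EuclideanSpace ℂ (Fin (T i))) (t : ℝ) :
    signal (Function.update x i fun k => x i k + (t : ℂ) • δ k) =
      signal x + t • signal (Function.update x i δ) := by
  ext r
  have h : signal x r = signal (Function.update x i (x i)) r := by
    rw [Function.update_eq_self]
  rw [Pi.add_apply, Pi.smul_apply, h]
  simp only [signal, prod_update_apply, Finset.smul_sum, ← Finset.sum_add_distrib]
  refine Finset.sum_congr rfl fun k _ => ?_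
  simp
  ring

/-- The signal is unchanged when the factors of each user are scaled with product one. -/
lemma signal_smul (c : Fin (d + 1) → Fin K → ℂ) (hc : ∀ k, ∏ j, c j k = 1)
    (z : Factors d K T) : signal (fun j k => c j k • z j k : Factors d K T) = signal z := by
  ext r
  simp only [signal, PiLp.smul_apply, smul_eq_mul, Finset.prod_mul_distrib, hc, one_mul]

/-- The line `x + t δ` in mode `i`, normalised to satisfy the constraints, with the scaling
factors moved to the channels. -/
noncomputable def gaugedLine (x : Factors d K T) (i : Fin d)
    (δ : Fin K → EuclideanSpace ℂ (Fin (T i.castSucc))) (t : ℝ) : Factors d K T := fun j k =>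
  ((if j = i.castSucc then
        (gauge (x i.castSucc k) (x i.castSucc k + (t : ℂ) • δ k))⁻¹ else 1) *
      if j = Fin.last d then
        gauge (x i.castSucc k) (x i.castSucc k + (t : ℂ) • δ k) else 1) •
    Function.update x i.castSucc (fun k => x i.castSucc k + (t : ℂ) • δ k) j k

variable {i : Fin d} {δ : Fin K → EuclideanSpace ℂ (Fin (T i.castSucc))}

lemma gaugedLine_castSucc (t : ℝ) (k : Fin K) :
    gaugedLine x i δ t i.castSucc k =
      (gauge (x i.castSucc k) (x i.castSucc k + (t : ℂ) • δ k))⁻¹ •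
        (x i.castSucc k + (t : ℂ) • δ k) := by
  simp [gaugedLine, (Fin.castSucc_lt_last i).ne]

lemma gaugedLine_zero (hx : ∀ k, x i.castSucc k ≠ 0) : gaugedLine x i δ 0 = x := by
  ext j k : 2
  simp only [gaugedLine, Complex.ofReal_zero, zero_smul, add_zero, gauge_self (hx _),
    Function.update_eq_self]
  simp

lemma differentiableAt_gaugedLine (hx : ∀ k, x i.castSucc k ≠ 0) :
    DifferentiableAt ℝ (gaugedLine x i δ) 0 := by
  rw [differentiableAt_pi]
  intro j
  rw [differentiableAt_pi]
  intro k
  have hg := differentiableAt_gauge (hx k) (δ k)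
  have hg0 : gauge (x i.castSucc k) (x i.castSucc k + ((0 : ℝ) : ℂ) • δ k) ≠ 0 := by
    simp [gauge_self (hx k)]
  unfold gaugedLine
  refine DifferentiableAt.fun_smul (DifferentiableAt.fun_mul ?_ ?_) ?_
  · split_ifs
    · exact hg.fun_inv hg0
    · exact differentiableAt_const _
  · split_ifs
    · exact hg
    · exact differentiableAt_const _
  · by_cases h : j = i.castSucc
    · subst h
      simp only [Function.update_self, Complex.coe_smul]
      fun_prop
    · simp only [Function.update_of_ne h]
      exact differentiableAt_const _

lemma tendsto_gaugedLine (hx : ∀ k, x i.castSucc k ≠ 0) :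
    Tendsto (gaugedLine x i δ) (𝓝[≠] 0) (𝓝 x) := by
  have h := (differentiableAt_gaugedLine (δ := δ) hx).continuousAt.tendsto
  rw [gaugedLine_zero hx] at h
  exact h.mono_left nhdsWithin_le_nhds

lemma gaugedLine_sub_isBigO (hx : ∀ k, x i.castSucc k ≠ 0) :
    (fun t => gaugedLine x i δ t - x) =O[𝓝[≠] 0] fun t : ℝ => t := by
  have h := (differentiableAt_gaugedLine (δ := δ) hx).isBigO_sub
  rw [gaugedLine_zero hx] at h
  simpa using h.mono nhdsWithin_le_nhds

/-- Where this inner product vanishes the gauge is zero and cannot be cancelled, so the properties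
of `gaugedLine` are claimed only for small `t`. -/
lemma eventually_inner_ne_zero (hx : ∀ k, x i.castSucc k ≠ 0) :
    ∀ᶠ t : ℝ in 𝓝[≠] 0, ∀ k,
      inner ℂ (x i.castSucc k) (x i.castSucc k + (t : ℂ) • δ k) ≠ 0 := by
  rw [eventually_all]
  intro k
  have hc : Continuous fun t : ℝ => inner ℂ (x i.castSucc k) (x i.castSucc k + (t : ℂ) • δ k) := by
    fun_prop
  refine (hc.tendsto 0).mono_left nhdsWithin_le_nhds |>.eventually_ne ?_
  simpa using hx k

lemma eventually_signal_gaugedLine (hx : ∀ k, x i.castSucc k ≠ 0) :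
    ∀ᶠ t in 𝓝[≠] (0 : ℝ), signal (gaugedLine x i δ t) =
      signal x + t • signal (Function.update x i.castSucc δ) := by
  filter_upwards [eventually_inner_ne_zero (δ := δ) hx] with t ht
  rw [← signal_update_add_smul]
  refine signal_smul _ (fun k => ?_) _
  -- Mode `i` contributes the inverse gauge, the channel the gauge itself.
  rw [Finset.prod_mul_distrib, Finset.prod_ite_eq', Finset.prod_ite_eq']
  simp only [Finset.mem_univ, if_true]
  exact inv_mul_cancel₀ (gauge_ne_zero (ht k))

/-- Mode `i` is normalised by the gauge and the other information modes stay at `x`; the channel,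
which absorbs the scalar, is unconstrained. -/
lemma eventually_satisfiesConstraints_gaugedLine
    (hc : ∀ (j : Fin d) (k : Fin K), ‖x j.castSucc k‖ ^ 2 = (T j.castSucc : ℝ))
    (hx : ∀ k, x i.castSucc k ≠ 0) :
    ∀ᶠ t in 𝓝[≠] (0 : ℝ), SatisfiesConstraints x (gaugedLine x i δ t) := by
  filter_upwards [eventually_inner_ne_zero (δ := δ) hx] with t ht j k
  refine ⟨?_, hc j k, ?_⟩
  all_goals
    by_cases h : j = i
    · subst h
      rw [gaugedLine_castSucc]
      first
        | rw [norm_inv_gauge_smul (ht k)]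
        | exact im_inner_inv_gauge_smul (ht k)
    · have h' : j.castSucc ≠ i.castSucc := fun e => h (Fin.castSucc_injective _ e)
      have e : gaugedLine x i δ t j.castSucc k = x j.castSucc k := by
        simp [gaugedLine, h', (Fin.castSucc_lt_last j).ne]
      rw [e]
      try
        rw [inner_self_eq_norm_sq_to_K]
        norm_cast

end Curve

end TensorCRB

namespace TensorCRB

/-! ### Mean of the estimator along the curves -/

section Bias

variable {d K : ℕ} {T : Fin (d + 1) → ℕ} {σ : ℝ} {x : Factors d K T}
  {Z : Observation d T → Factors d K T} {α : Factors d K T → Fin d → Fin K → ℝ}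

lemma norm_sq_eq_of_constraints (hconstr : ∀ y, SatisfiesConstraints x (Z y)) (j : Fin d)
    (k : Fin K) : ‖x j.castSucc k‖ ^ 2 = (T j.castSucc : ℝ) :=
  -- The norm of `x` does not depend on the observation, so any `y` serves, here `0`.
  (hconstr 0 j k).2.1

lemma norm_estimator_eq (hconstr : ∀ y, SatisfiesConstraints x (Z y)) (j : Fin d)
    (k : Fin K) (y : Observation d T) : ‖Z y j.castSucc k‖ = ‖x j.castSucc k‖ :=
  (pow_left_inj₀ (norm_nonneg _) (norm_nonneg _) two_ne_zero).1 (hconstr y j k).1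

/-- The norm constraint bounds the estimator, so all moments exist under every finite law. -/
lemma memLp_estimator (hZ : Measurable Z) (hconstr : ∀ y, SatisfiesConstraints x (Z y))
    (j : Fin d) (k : Fin K) (μ : Measure (Observation d T)) [IsFiniteMeasure μ] (p : ℝ≥0∞) :
    MemLp (fun y => Z y j.castSucc k) p μ := by
  have hm : Measurable fun y => Z y j.castSucc k :=
    (measurable_pi_apply k).comp ((measurable_pi_apply j.castSucc).comp hZ)
  exact MemLp.of_bound hm.aestronglyMeasurable ‖x j.castSucc k‖
    (Eventually.of_forall fun y => (norm_estimator_eq hconstr j k y).le)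

lemma integral_inner_estimator (hZ : Measurable Z)
    (hconstr : ∀ y, SatisfiesConstraints x (Z y)) (j : Fin d) (k : Fin K)
    (v : EuclideanSpace ℂ (Fin (T j.castSucc))) (θ : Factors d K T) :
    ∫ y, inner ℂ v (Z y j.castSucc k) ∂(obsLaw σ θ) =
      inner ℂ v (∫ y, Z y j.castSucc k ∂(obsLaw σ θ)) :=
  integral_inner ((memLp_estimator hZ hconstr j k _ 1).integrable le_rfl) v

variable {i : Fin d} {δ : Fin K → EuclideanSpace ℂ (Fin (T i.castSucc))}

/-- First-order expansion of the mean of the estimator along a gauged line. -/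
lemma bias_gaugedLine_isLittleO (hbias : HasScalarBias σ x Z α)
    (hc : ∀ (j : Fin d) (k : Fin K), ‖x j.castSucc k‖ ^ 2 = (T j.castSucc : ℝ))
    (hx : ∀ k, x i.castSucc k ≠ 0) (k : Fin K) :
    (fun t : ℝ => (∫ y, Z y i.castSucc k ∂(obsLaw σ (gaugedLine x i δ t))) -
      (α (gaugedLine x i δ t) i k : ℂ) • gaugedLine x i δ t i.castSucc k)
      =o[𝓝[≠] 0] fun t : ℝ => t := by
  have ht : Tendsto (gaugedLine x i δ) (𝓝[≠] 0) (𝓝[{θ | SatisfiesConstraints x θ}] x) :=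
    tendsto_nhdsWithin_iff.2
      ⟨tendsto_gaugedLine hx, eventually_satisfiesConstraints_gaugedLine hc hx⟩
  exact ((hbias i k).2.comp_tendsto ht).trans_isBigO (gaugedLine_sub_isBigO hx)

lemma tendsto_inv_gauge (hx : ∀ k, x i.castSucc k ≠ 0) (k : Fin K) :
    Tendsto (fun t : ℝ => (gauge (x i.castSucc k) (x i.castSucc k + (t : ℂ) • δ k))⁻¹)
      (𝓝[≠] 0) (𝓝 1) := by
  have h := (differentiableAt_gauge (hx k) (δ k)).continuousAt.tendsto
  simp only [Complex.ofReal_zero, zero_smul, add_zero, gauge_self (hx k)] at h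
  simpa using (h.mono_left nhdsWithin_le_nhds).inv₀ one_ne_zero

/-- The bias factors converge along a gauged line. -/
lemma tendsto_bias_gaugedLine (hσ : 0 < σ) (hZ : Measurable Z)
    (hconstr : ∀ y, SatisfiesConstraints x (Z y)) (hbias : HasScalarBias σ x Z α)
    (hx : ∀ k, x i.castSucc k ≠ 0) (k : Fin K) :
    Tendsto (fun t : ℝ => (α (gaugedLine x i δ t) i k : ℂ)) (𝓝[≠] 0) (𝓝 (α x i k : ℂ)) := by
  set a := x i.castSucc k with ha
  have hca := norm_sq_eq_of_constraints hconstr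
  have hmean : Tendsto (fun t : ℝ => inner ℂ a (∫ y, Z y i.castSucc k
      ∂(obsLaw σ (gaugedLine x i δ t)))) (𝓝[≠] 0) (𝓝 ((α x i k : ℂ) * inner ℂ a a)) := by
    have h := tendsto_integral_obsLaw (x := x) hσ
      ((memLp_estimator hZ hconstr i k (obsLaw σ x) 2).const_inner a)
      (eventually_signal_gaugedLine (δ := δ) hx)
    simp only [integral_inner_estimator hZ hconstr, (hbias i k).1, inner_smul_right] at h
    exact h
  have hid : Tendsto (fun t : ℝ => t) (𝓝[≠] 0) (𝓝 0) := nhdsWithin_le_nhds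
  have hrem := (bias_gaugedLine_isLittleO (δ := δ) hbias hca hx k).trans_tendsto hid
  have hrem' := (tendsto_const_nhds (x := a)).inner (𝕜 := ℂ) hrem
  rw [inner_zero_right] at hrem'
  have hθ : Tendsto (fun t : ℝ => inner ℂ a (gaugedLine x i δ t i.castSucc k)) (𝓝[≠] 0)
      (𝓝 (inner ℂ a a)) := by
    have h : Tendsto (fun t : ℝ => gaugedLine x i δ t i.castSucc k) (𝓝[≠] 0) (𝓝 a) :=
      tendsto_pi_nhds.1 (tendsto_pi_nhds.1 (tendsto_gaugedLine hx) i.castSucc) k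
    exact tendsto_const_nhds.inner h
  have haa : inner ℂ a a ≠ 0 := inner_self_ne_zero.2 (hx k)
  -- Pairing the bias relation with `a` and solving for the factor writes `α` as this quotient,
  -- whose denominator tends to `‖a‖² ≠ 0`.
  have hq := (hmean.sub hrem').div hθ haa
  rw [sub_zero, mul_div_cancel_right₀ _ haa] at hq
  refine hq.congr' ?_
  filter_upwards [hθ.eventually_ne haa] with t ht
  simp only [inner_sub_right, inner_smul_right, Pi.div_apply]
  field_simp
  ring

/-- The derivative, along a gauged line, of a component of the mean of the estimator orthogonal
to the true factor. -/
lemma tendsto_slope_mean (hσ : 0 < σ) (hZ : Measurable Z)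
    (hconstr : ∀ y, SatisfiesConstraints x (Z y)) (hbias : HasScalarBias σ x Z α)
    (hx : ∀ k, x i.castSucc k ≠ 0) (k : Fin K) {v : EuclideanSpace ℂ (Fin (T i.castSucc))}
    (hv : inner ℂ v (x i.castSucc k) = 0) :
    Tendsto (fun t : ℝ => (t : ℂ)⁻¹ *
      ∫ y, inner ℂ v (Z y i.castSucc k) ∂(obsLaw σ (gaugedLine x i δ t))) (𝓝[≠] 0)
      (𝓝 ((α x i k : ℂ) * inner ℂ v (δ k))) := by
  have hca := norm_sq_eq_of_constraints hconstr
  have hrem : Tendsto (fun t : ℝ => t⁻¹ • ((∫ y, Z y i.castSucc k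
      ∂(obsLaw σ (gaugedLine x i δ t))) -
      (α (gaugedLine x i δ t) i k : ℂ) • gaugedLine x i δ t i.castSucc k)) (𝓝[≠] 0) (𝓝 0) :=
    (bias_gaugedLine_isLittleO (δ := δ) hbias hca hx k).tendsto_inv_smul_nhds_zero
  have hrem' := (tendsto_const_nhds (x := v)).inner (𝕜 := ℂ) hrem
  rw [inner_zero_right] at hrem'
  -- Since `v` is orthogonal to `x_{i,k}`, the pairing of `v` with the curve is `t` times the
  -- inverse gauge times `⟨v, δ_k⟩`. After division by `t` only the limits of `α` and of the gauge
  -- matter.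
  have hm := ((tendsto_bias_gaugedLine (δ := δ) hσ hZ hconstr hbias hx k).mul
    ((tendsto_inv_gauge (δ := δ) hx k).mul_const (inner ℂ v (δ k)))).add hrem'
  rw [one_mul, add_zero] at hm
  refine hm.congr' ?_
  filter_upwards [self_mem_nhdsWithin] with t ht
  have ht' : (t : ℂ) ≠ 0 := by exact_mod_cast ht
  rw [integral_inner_estimator hZ hconstr, gaugedLine_castSucc, ← Complex.coe_smul]
  simp only [inner_sub_right, inner_smul_right, inner_add_right, hv]
  push_cast
  field_simp
  ring

/-- **Cramér–Rao bound** for a unit direction `v` orthogonal to the true factor: perturbations of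
mode `i` of user `k` along `v` can be combined with perturbations `g` of the other users. -/
lemma directional_variance_bound (hσ : 0 < σ) (hZ : Measurable Z)
    (hconstr : ∀ y, SatisfiesConstraints x (Z y)) (hbias : HasScalarBias σ x Z α)
    (hx : ∀ k, x i.castSucc k ≠ 0) (k : Fin K) {v : EuclideanSpace ℂ (Fin (T i.castSucc))}
    (hv : inner ℂ v (x i.castSucc k) = 0) (hv1 : ‖v‖ = 1) (g : Fin K → ℂ) (hg : g k = 1) :
    α x i k ^ 2 * σ ^ 2 ≤
      (∫ y, ‖inner ℂ v (Z y i.castSucc k)‖ ^ 2 ∂(obsLaw σ x)) *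
        ‖∑ k', g k' • partialKron x i.castSucc k'‖ ^ 2 := by
  have h0 : ∫ y, inner ℂ v (Z y i.castSucc k) ∂(obsLaw σ x) = 0 := by
    rw [integral_inner_estimator hZ hconstr, (hbias i k).1, inner_smul_right, hv, mul_zero]
  have hvv : inner ℂ v v = (1 : ℂ) := by rw [inner_self_eq_norm_sq_to_K, hv1]; simp
  have hI : signal (Function.update x i.castSucc fun k' => Complex.I • g k' • v) =
      Complex.I • signal (Function.update x i.castSucc fun k' => g k' • v) := by
    ext r
    simp only [signal, prod_update_apply, Pi.smul_apply, Finset.smul_sum]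
    refine Finset.sum_congr rfl fun k' _ => ?_
    simp
    ring
  have h := cramer_rao_complex_direction hσ
    ((memLp_estimator hZ hconstr i k (obsLaw σ x) 2).const_inner v) h0
    (eventually_signal_gaugedLine (δ := fun k' => g k' • v) hx)
    (by
      rw [← hI]
      exact eventually_signal_gaugedLine (δ := fun k' => Complex.I • g k' • v) hx)
    (tendsto_slope_mean hσ hZ hconstr hbias hx k hv)
    (by
      have := tendsto_slope_mean (δ := fun k' => Complex.I • g k' • v) hσ hZ hconstr hbias hx k hv
      rwa [inner_smul_right, mul_left_comm] at this)
  have hsum : ∑ r, ‖signal (Function.update x i.castSucc fun k' => g k' • v) r‖ ^ 2 =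
      ‖∑ k', g k' • partialKron x i.castSucc k'‖ ^ 2 := by
    -- All users move along the same `v`, so the signal direction is the pure tensor `v ⊗ ∑ g_{k'}
    -- s_{-i,k'}` and its norm factors.
    have e : ∀ r, signal (Function.update x i.castSucc fun k' => g k' • v) r =
        v (r i.castSucc) * (∑ k', g k' • partialKron x i.castSucc k') fun m => r m := by
      intro r
      simp only [signal, prod_update_apply, WithLp.ofLp_sum, Finset.sum_apply, Finset.mul_sum]
      refine Finset.sum_congr rfl fun k' _ => ?_
      simp
      ring
    simp_rw [e, norm_mul, mul_pow]
    rw [← (Equiv.piSplitAt i.castSucc fun j => Fin (T j)).symm.sum_comp, Fintype.sum_prod_type]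
    have e1 : ∀ (a : Fin (T i.castSucc)) (b : (m : {m // m ≠ i.castSucc}) → Fin (T m)),
        ((Equiv.piSplitAt i.castSucc fun j => Fin (T j)).symm (a, b)) i.castSucc = a := by
      intro a b
      simp [Equiv.piSplitAt]
    have e2 : ∀ (a : Fin (T i.castSucc)) (b : (m : {m // m ≠ i.castSucc}) → Fin (T m)),
        (fun m : {m // m ≠ i.castSucc} =>
          ((Equiv.piSplitAt i.castSucc fun j => Fin (T j)).symm (a, b)) m) = b := by
      intro a b
      ext m
      simp [Equiv.piSplitAt, m.2]
    simp_rw [e1, e2, ← Finset.mul_sum]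
    rw [← Finset.sum_mul, ← EuclideanSpace.norm_sq_eq, ← EuclideanSpace.norm_sq_eq, hv1]
    simp
  rw [hsum, hg, one_smul, hvv, mul_one, Complex.norm_real, Real.norm_eq_abs, sq_abs] at h
  exact h

end Bias

/-! ### Summing over directions; the single-user case -/

section Bound

variable {d K : ℕ} {T : Fin (d + 1) → ℕ} {σ : ℝ}

/-- The residual is a combination of the partial Kronecker products in which that of user `k`
has coefficient one. -/
lemma exists_residual_eq_sum (x : Factors d K T) (i : Fin (d + 1)) (k : Fin K) :
    ∃ g : Fin K → ℂ, g k = 1 ∧ residual x i k = ∑ k', g k' • partialKron x i k' := by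
  set W := Submodule.span ℂ (Set.range fun k' : {k' : Fin K // k' ≠ k} => partialKron x i k')
    with hW
  obtain ⟨c, hc⟩ := (Submodule.mem_span_range_iff_exists_fun ℂ).1
    (W.starProjection_apply_mem (partialKron x i k))
  refine ⟨fun k' => if h : k' = k then 1 else - c ⟨k', h⟩, by simp, ?_⟩
  have hr : residual x i k = partialKron x i k - W.starProjection (partialKron x i k) := by
    change Wᗮ.starProjection (partialKron x i k) = _
    rw [Submodule.starProjection_orthogonal_val]
  rw [hr, ← hc, Fintype.sum_eq_add_sum_subtype_ne _ k, sub_eq_add_neg, ← Finset.sum_neg_distrib]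
  congr 1
  · simp
  · refine Finset.sum_congr rfl fun k' _ => ?_
    simp [k'.2]

lemma norm_partialKron_sq (x : Factors d K T) (i : Fin (d + 1)) (k : Fin K) :
    ‖partialKron x i k‖ ^ 2 = ∏ j ∈ Finset.univ.filter (fun j => j ≠ i), ‖x j k‖ ^ 2 := by
  rw [EuclideanSpace.norm_sq_eq]
  simp only [partialKron, norm_prod, ← Finset.prod_pow, EuclideanSpace.norm_sq_eq]
  rw [← Finset.prod_subtype_eq_prod_filter]
  simp only [Finset.subtype_univ]
  exact (Fintype.prod_sum fun (m : {m : Fin (d + 1) // m ≠ i}) a => ‖x m k a‖ ^ 2).symm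

lemma residual_eq_of_subsingleton [Subsingleton (Fin K)] (x : Factors d K T) (i : Fin (d + 1))
    (k : Fin K) : residual x i k = partialKron x i k := by
  have : IsEmpty {k' : Fin K // k' ≠ k} := ⟨fun k' => k'.2 (Subsingleton.elim _ _)⟩
  rw [residual]
  simp only [Set.range_eq_empty, Submodule.span_empty, Submodule.bot_orthogonal_eq_top]
  exact Submodule.starProjection_eq_self_iff.2 Submodule.mem_top

lemma frobeniusSq_nonneg {m n : Type} [Fintype m] [Fintype n] (A : Matrix m n ℂ) :
    0 ≤ frobeniusSq A :=
  Finset.sum_nonneg fun _ _ => Finset.sum_nonneg fun _ _ => by positivity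

/-- Without interferers `U_i` has no columns and the projection is the identity, so the residual
norm is that of a Kronecker product. -/
lemma varianceBound_eq_singleUserBound [Subsingleton (Fin K)] (x : Factors d K T)
    (i : Fin (d + 1)) (k : Fin K) {ι κ : Type} [Fintype ι] [Fintype κ]
    (u : OrthonormalBasis ι ℂ (interferenceSpan x i k))
    (v : OrthonormalBasis κ ℂ (Submodule.span ℂ {x i k})ᗮ) :
    varianceBound σ x i k u v = singleUserBound σ x i k := by
  have hk : IsEmpty {k' : Fin K // k' ≠ k} := ⟨fun k' => k'.2 (Subsingleton.elim _ _)⟩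
  have hbot : interferenceSpan x i k = ⊥ := by
    rw [interferenceSpan, Set.range_eq_empty, Submodule.span_empty]
  have hι : IsEmpty ι := by
    refine ⟨fun a => ?_⟩
    have h0 : u a = 0 := by
      apply Subtype.ext
      exact (Submodule.mem_bot ℂ).1 (hbot ▸ (u a).2)
    have h1 := u.norm_eq_one a
    rw [h0, norm_zero] at h1
    exact zero_ne_one h1
  rw [varianceBound, singleUserBound, residual_eq_of_subsingleton, norm_partialKron_sq,
    frobeniusSq, Finset.univ_eq_empty, Finset.sum_empty, sub_zero, mul_comm (σ ^ 2)]

/-- **Cramér–Rao bound** with all users' factors in mode `i` and all channels unknown. -/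
lemma normalizedVariance_ge (hσ : 0 < σ) {x : Factors d K T}
    {Z : Observation d T → Factors d K T} (hZ : Measurable Z)
    {α : Factors d K T → Fin d → Fin K → ℝ}
    (hconstr : ∀ y, SatisfiesConstraints x (Z y)) (hbias : HasScalarBias σ x Z α)
    {i : Fin d} {k : Fin K} (hα : α x i k ≠ 0) (hT : 1 < T i.castSucc) {κ : Type} [Fintype κ]
    (v : OrthonormalBasis κ ℂ (Submodule.span ℂ {x i.castSucc k})ᗮ) :
    ((T i.castSucc : ℝ) - 1) * σ ^ 2 / ((T i.castSucc : ℝ) * ‖residual x i.castSucc k‖ ^ 2) ≤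
      normalizedVariance σ x Z (α x i k) i.castSucc k := by
  have hTr1 : (1 : ℝ) < T i.castSucc := by exact_mod_cast hT
  have hTr : (0 : ℝ) < T i.castSucc := zero_lt_one.trans hTr1
  have hx : ∀ k, x i.castSucc k ≠ 0 := by
    intro k' h
    have := norm_sq_eq_of_constraints hconstr i k'
    rw [h, norm_zero, zero_pow two_ne_zero] at this
    exact hTr.ne this
  set a := x i.castSucc k with ha
  set r := ‖residual x i.castSucc k‖ ^ 2 with hr
  have hva : ∀ c, inner ℂ (v c : EuclideanSpace ℂ (Fin (T i.castSucc))) a = 0 := fun c =>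
    Submodule.inner_left_of_mem_orthogonal (Submodule.mem_span_singleton_self a) (v c).2
  have hdir : ∀ c, α x i k ^ 2 * σ ^ 2 ≤
      (∫ y, ‖inner ℂ (v c : EuclideanSpace ℂ (Fin (T i.castSucc))) (Z y i.castSucc k)‖ ^ 2
        ∂(obsLaw σ x)) * r := by
    intro c
    obtain ⟨g, hg, hres⟩ := exists_residual_eq_sum x i.castSucc k
    rw [hr, hres]
    exact directional_variance_bound hσ hZ hconstr hbias hx k (hva c) (v.norm_eq_one c) g hg
  have hcard : (Fintype.card κ : ℝ) = (T i.castSucc : ℝ) - 1 := by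
    have h1 := Submodule.finrank_add_finrank_orthogonal (Submodule.span ℂ {a})
    rw [finrank_span_singleton (hx k), Module.finrank_eq_card_basis v.toBasis, finrank_euclideanSpace_fin] at h1
    rw [← h1]
    push_cast
    ring
  have hL := memLp_estimator hZ hconstr i k (obsLaw σ x) 2
  have horth : Orthonormal ℂ fun c => (v c : EuclideanSpace ℂ (Fin (T i.castSucc))) :=
    v.orthonormal.comp_linearIsometry (Submodule.subtypeₗᵢ _)
  -- Subtracting the mean `α a` does not change the components along `v c`, which are orthogonal to
  -- `a`; Bessel is applied for each `y`.
  have hbessel : ∑ c, ∫ y, ‖inner ℂ (v c : EuclideanSpace ℂ (Fin (T i.castSucc)))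
      (Z y i.castSucc k)‖ ^ 2 ∂(obsLaw σ x) ≤
      ∫ y, ‖Z y i.castSucc k - (α x i k : ℂ) • a‖ ^ 2 ∂(obsLaw σ x) := by
    have hi : ∀ c ∈ Finset.univ, Integrable (fun y => ‖inner ℂ
        (v c : EuclideanSpace ℂ (Fin (T i.castSucc))) (Z y i.castSucc k)‖ ^ 2) (obsLaw σ x) :=
      fun c _ => (hL.const_inner (𝕜 := ℂ) _).integrable_norm_pow two_ne_zero
    rw [← integral_finsetSum _ hi]
    refine integral_mono (integrable_finsetSum _ hi)
      ((hL.sub (memLp_const _)).integrable_norm_pow two_ne_zero) fun y => ?_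
    have h := horth.sum_inner_products_le (x := Z y i.castSucc k - (α x i k : ℂ) • a)
      (s := Finset.univ)
    simpa only [inner_sub_right, inner_smul_right, hva, mul_zero, sub_zero] using h
  have hα2 : 0 < α x i k ^ 2 := by positivity
  have hr0 : 0 ≤ r := by positivity
  -- A zero residual would contradict the directional bound, since `α² σ² > 0`; a direction exists
  -- because `T_i > 1`.
  have hr1 : 0 < r := by
    have hκ : 0 < Fintype.card κ := by
      rw [← Nat.cast_pos (α := ℝ), hcard]
      linarith
    obtain ⟨c⟩ := Fintype.card_pos_iff.1 hκ
    refine hr0.lt_of_ne fun h => ?_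
    have := hdir c
    rw [← h, mul_zero] at this
    exact absurd this (not_le.2 (by positivity))
  have hmain : ((T i.castSucc : ℝ) - 1) * (α x i k ^ 2 * σ ^ 2) ≤
      (∫ y, ‖Z y i.castSucc k - (α x i k : ℂ) • a‖ ^ 2 ∂(obsLaw σ x)) * r := by
    refine le_trans ?_ (mul_le_mul_of_nonneg_right hbessel hr0)
    rw [← hcard, Finset.sum_mul, ← nsmul_eq_mul, ← Finset.card_univ]
    exact Finset.card_nsmul_le_sum _ _ _ fun c _ => hdir c
  change _ ≤ (∫ y, ‖Z y i.castSucc k - (α x i k : ℂ) • a‖ ^ 2 ∂(obsLaw σ x)) /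
    ((T i.castSucc : ℝ) * α x i k ^ 2)
  generalize ∫ y, ‖Z y i.castSucc k - (α x i k : ℂ) • a‖ ^ 2 ∂(obsLaw σ x) = V at hmain ⊢
  clear_value r
  rw [div_le_div_iff₀ (by positivity) (by positivity)]
  linear_combination (T i.castSucc : ℝ) * hmain

end Bound

end TensorCRB

/-! ### The stated bound -/

theorem proposition1 {d K : ℕ} {T : Fin (d + 1) → ℕ}
    (hT : ∀ i : Fin d, 1 < T i.castSucc)
    {σ : ℝ} (hσ : 0 < σ)
    (x : TensorCRB.Factors d K T)
    (Z : TensorCRB.Observation d T → TensorCRB.Factors d K T)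
    (hZ : Measurable Z)
    (α : TensorCRB.Factors d K T → Fin d → Fin K → ℝ)
    (hconstr : ∀ y, TensorCRB.SatisfiesConstraints x (Z y))
    (hbias : TensorCRB.HasScalarBias σ x Z α)
    (i : Fin d) (k : Fin K)
    (hα : α x i k ≠ 0)
    (hΓ : IsUnit (TensorCRB.gram x i.castSucc))
    {ι κ : Type} [Fintype ι] [Fintype κ]
    (u : OrthonormalBasis ι ℂ (TensorCRB.interferenceSpan x i.castSucc k))
    (v : OrthonormalBasis κ ℂ (Submodule.span ℂ {x i.castSucc k})ᗮ) :
    TensorCRB.normalizedVariance σ x Z (α x i k) i.castSucc k ≥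
        TensorCRB.varianceBound σ x i.castSucc k u v ∧
      (K = 1 →
        TensorCRB.varianceBound σ x i.castSucc k u v =
            TensorCRB.singleUserBound σ x i.castSucc k ∧
          TensorCRB.normalizedVariance σ x Z (α x i k) i.castSucc k ≥
            TensorCRB.singleUserBound σ x i.castSucc k) := by
  have hge := TensorCRB.normalizedVariance_ge hσ hZ hconstr hbias hα (hT i) v
  have hmain : TensorCRB.normalizedVariance σ x Z (α x i k) i.castSucc k ≥
      TensorCRB.varianceBound σ x i.castSucc k u v := by
    -- Dropping the nonnegative Frobenius term from the numerator only increases the bound.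
    refine le_trans ?_ hge
    unfold TensorCRB.varianceBound
    have := TensorCRB.frobeniusSq_nonneg
      ((TensorCRB.matrixU x i.castSucc k u)ᴴ * TensorCRB.matrixV x i.castSucc k v)
    refine div_le_div_of_nonneg_right (mul_le_mul_of_nonneg_right ?_ ?_) ?_
    · linarith
    · positivity
    · positivity
  refine ⟨hmain, fun hK => ?_⟩
  subst hK
  have heq := TensorCRB.varianceBound_eq_singleUserBound (σ := σ) x i.castSucc k u v
  exact ⟨heq, heq ▸ hmain⟩
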